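/- Let $n\ge 1$ and let $X_1,\dots,X_n$ be i.i.d., absolutely continuous, nonnegative real random variables. Let $I,J\subseteq\mathbb R$ be intervals with more than one point (for instance $[0,\infty)$, $(0,\infty)$ or $\mathbb R$), and let $\varphi:I\to[0,\infty)$ and $\psi:J\to[0,\infty)$ be twice continuously differentiable (one-sided derivatives at endpoints that belong to the interval) and strictly monotone (each one strictly increasing or strictly decreasing), such that for all $u\in I$ and $v\in J$ $$\varphi''(u)\ge 0,\qquad \varphi''(u)\,\psi''(v)\,\varphi(u)\,\psi(v)\ \ge\ \bigl(\varphi'(u)\,\psi'(v)\bigr)^2 .$$ Assume that $X_1\in\psi(J)$ almost surely and that $\psi^{-1}(X_1)$ has a log-concave density, that is, a Lebesgue density $f:\mathbb R\to[0,\infty)$ with $f(\alpha x+(1-\alpha)y)\ge f(x)^{\alpha}f(y)^{1-\alpha}$ for all $x,y\in\mathbb R$, $\alpha\in[0,1]$. Let $a_1,\dots,a_n,b_1,\dots,b_n\in\varphi(I)$, and put $x_i=\varphi^{-1}(a_i)$, $y_i=\varphi^{-1}(b_i)$, with increasing arrangements $x_{(1)}\le\dots\le x_{(n)}$ and $y_{(1)}\le\dots\le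 y_{(n)}$. 1. If $x$ majorizes $y$, i.e. $\sum_{i=1}^n x_{(i)}=\sum_{i=1}^n y_{(i)}$ and $\sum_{i=1}^j y_{(i)}\ge\sum_{i=1}^j x_{(i)}$ for $j=1,\dots,n-1$, then $\sum_{i=1}^n a_iX_i\ge_{\mathrm{st}}\sum_{i=1}^n b_iX_i$, i.e. $P\bigl(\sum_{i} a_iX_i\le t\bigr)\le P\bigl(\sum_{i} b_iX_i\le t\bigr)$ for every $t\in\mathbb R$. 2. If $\varphi$ is increasing, the same conclusion holds when $x$ only weakly submajorizes $y$, i.e. $\sum_{i=j}^n y_{(i)}\le\sum_{i=j}^n x_{(i)}$ for $j=1,\dots,n$. 3. If $\varphi$ is decreasing, the same conclusion holds when $x$ only weakly supmajorizes $y$, i.e. $\sum_{i=1}^j y_{(i)}\ge\sum_{i=1}^j x_{(i)}$ for $j=1,\dots,n$. -/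

import Mathlib

open MeasureTheory ProbabilityTheory

/-- The increasing arrangement `x_(1) ≤ x_(2) ≤ ⋯ ≤ x_(n)` of the components of `x`
(with positions numbered from `0`). -/
noncomputable def incrArr {n : ℕ} (x : Fin n → ℝ) : Fin n → ℝ := x ∘ Tuple.sort x

/-- `x` is majorized by `y`: equal totals, and every sum of the smallest components of `x`
is at least the corresponding sum for `y`. -/
def MajorizedBy {n : ℕ} (x y : Fin n → ℝ) : Prop :=
  ∑ i, incrArr x i = ∑ i, incrArr y i ∧
    ∀ j : Fin n, ∑ i ∈ Finset.Iic j, incrArr y i ≤ ∑ i ∈ Finset.Iic j, incrArr x i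

/-- `x` is weakly supmajorized by `y`. -/
def SupmajorizedBy {n : ℕ} (x y : Fin n → ℝ) : Prop :=
  ∀ j : Fin n, ∑ i ∈ Finset.Iic j, incrArr y i ≤ ∑ i ∈ Finset.Iic j, incrArr x i

/-- `x` is weakly submajorized by `y`. -/
def SubmajorizedBy {n : ℕ} (x y : Fin n → ℝ) : Prop :=
  ∀ j : Fin n, ∑ i ∈ Finset.Ici j, incrArr x i ≤ ∑ i ∈ Finset.Ici j, incrArr y i

/-- The usual stochastic order: `X` is stochastically smaller than `Y` if the distribution
function of `X` is everywhere at least that of `Y`. -/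
def StochLE {Ω : Type*} [MeasurableSpace Ω] (P : Measure Ω) (X Y : Ω → ℝ) : Prop :=
  ∀ t : ℝ, P {ω | Y ω ≤ t} ≤ P {ω | X ω ≤ t}

/-- `h` is log-concave on `A`. -/
def LogConcaveOn (A : Set ℝ) (h : ℝ → ℝ) : Prop :=
  Convex ℝ A ∧ ∀ x ∈ A, ∀ y ∈ A, ∀ α ∈ Set.Icc (0 : ℝ) 1,
    h x ^ α * h y ^ (1 - α) ≤ h (α * x + (1 - α) * y)

/-- `Y` is a (real) random variable whose law has a log-concave density with respect to
Lebesgue measure. The density is a function on the whole line, equal to `0` off its support. -/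
def HasLogConcaveDensity {Ω : Type*} [MeasurableSpace Ω] (P : Measure Ω) (Y : Ω → ℝ) : Prop :=
  AEMeasurable Y P ∧ ∃ f : ℝ → ℝ, Measurable f ∧ (∀ x, 0 ≤ f x) ∧ LogConcaveOn Set.univ f ∧
    P.map Y = volume.withDensity (fun x => ENNReal.ofReal (f x))

/-! Let `μ` be the law of `ψ⁻¹(X₁)`. For fixed `t` and `x ∈ I ^ n`, the probability that `∑ φ (x i)
* X i ≤ t` is `m x`, the `μ ^ n`-measure of the set of `v ∈ J ^ n` with `∑ φ (x i) * ψ (v i) ≤ t`.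
The differential inequality says that the Hessian of `φ u * ψ v` is positive semidefinite
(`convexOn_mul_of_iteratedDerivWithin`), so these sets are the fibres of one convex set in `(x, v)`.
Since `μ ^ n` satisfies Prékopa–Leindler (`isPrekopaLeindler_volume_real`, `IsPrekopaLeindler.pi`),
`m` is log-concave. It is also symmetric, hence `m x ≤ m z` for every `z` in the convex hull of the
rearrangements of `x` (`measure_mulSublevel_le_of_mem_permutohedron`).

Weak majorization provides such a `z` with `y ≤ z`, or `z ≤ y`, by Hahn–Banach and the rearrangement
inequality. Monotonicity of `φ` and `X i ≥ 0` then give `m z ≤ m y`. -/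

/-! ### Brunn–Minkowski on the line. -/

/-- The Brunn–Minkowski inequality on the line, for compact sets. -/
theorem volume_add_le_of_add_subset_of_isCompact {A B C : Set ℝ} (hA : IsCompact A)
    (hB : IsCompact B) (hA0 : A.Nonempty) (hB0 : B.Nonempty)
    (h : ∀ a ∈ A, ∀ b ∈ B, a + b ∈ C) : volume A + volume B ≤ volume C := by
  obtain ⟨m, hmA, hm⟩ := hA.exists_isGreatest hA0
  obtain ⟨l, hlB, hl⟩ := hB.exists_isLeast hB0
  -- The translates `A + min B` and `B + max A` both lie in `C` and meet at most at the point `max A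
  -- + min B`.
  have h1 : volume ((fun x => x + l) '' A) = volume A := by simp
  have h2 : volume ((fun x => x + m) '' B) = volume B := by simp
  have hcA : IsCompact ((fun x => x + l) '' A) := hA.image (by fun_prop)
  rw [← h1, ← h2]
  have hdisj : AEDisjoint volume ((fun x => x + l) '' A) ((fun x => x + m) '' B) := by
    refine measure_mono_null (t := {m + l}) ?_ (by simp)
    rintro _ ⟨⟨x, hx, rfl⟩, ⟨y, hy, hxy⟩⟩
    have h3 := hm hx
    have h4 := hl hy
    simp only [Set.mem_singleton_iff] at *
    linarith
  rw [← measure_union₀' hcA.measurableSet.nullMeasurableSet hdisj]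
  refine measure_mono ?_
  rintro _ (⟨x, hx, rfl⟩ | ⟨x, hx, rfl⟩)
  · exact h x hx l hlB
  · simpa [add_comm] using h m hmA x hx

/-- The Brunn–Minkowski inequality on the line. -/
theorem volume_add_le_of_add_subset {A B C : Set ℝ} (hA : MeasurableSet A)
    (hB : MeasurableSet B) (hA0 : A.Nonempty) (hB0 : B.Nonempty)
    (h : ∀ a ∈ A, ∀ b ∈ B, a + b ∈ C) : volume A + volume B ≤ volume C := by
  have key : ∀ A : Set ℝ, MeasurableSet A → A.Nonempty →
      volume A ≤ ⨆ K : Set ℝ, ⨆ _ : K ⊆ A ∧ IsCompact K ∧ K.Nonempty, volume K := by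
    intro A hA hA0
    rw [hA.measure_eq_iSup_isCompact]
    refine iSup_le fun K => iSup_le fun hKA => iSup_le fun hK => ?_
    obtain rfl | hK0 := K.eq_empty_or_nonempty
    · simp
    · exact le_iSup₂_of_le K ⟨hKA, hK, hK0⟩ le_rfl
  have ne : ∀ A : Set ℝ, A.Nonempty → ∃ K : Set ℝ, K ⊆ A ∧ IsCompact K ∧ K.Nonempty :=
    fun A ⟨a, ha⟩ => ⟨{a}, by simpa using ha, isCompact_singleton, by simp⟩
  refine (add_le_add (key A hA hA0) (key B hB hB0)).trans ?_
  refine ENNReal.biSup_add_biSup_le' (ne A hA0) (ne B hB0) ?_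
  rintro K ⟨hKA, hK, hK0⟩ L ⟨hLB, hL, hL0⟩
  exact volume_add_le_of_add_subset_of_isCompact hK hL hK0 hL0
    fun a ha b hb => h a (hKA ha) b (hLB hb)

open scoped Pointwise in
/-- The Brunn–Minkowski inequality on the line, for convex combinations. -/
theorem volume_convexComb_le {A B C : Set ℝ} {l : ℝ} (hl : l ∈ Set.Ioo (0 : ℝ) 1)
    (hA : MeasurableSet A) (hB : MeasurableSet B) (hA0 : A.Nonempty) (hB0 : B.Nonempty)
    (h : ∀ a ∈ A, ∀ b ∈ B, l * a + (1 - l) * b ∈ C) :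
    ENNReal.ofReal l * volume A + ENNReal.ofReal (1 - l) * volume B ≤ volume C := by
  have h1 : 0 < 1 - l := sub_pos.2 hl.2
  have e : ∀ {r : ℝ}, 0 < r → ∀ s : Set ℝ, volume (r • s) = ENNReal.ofReal r * volume s := by
    intro r hr s
    rw [Measure.addHaar_smul]
    simp [abs_of_pos hr]
  rw [← e hl.1, ← e h1]
  refine volume_add_le_of_add_subset (hA.const_smul₀ l) (hB.const_smul₀ (1 - l))
    hA0.smul_set hB0.smul_set ?_
  rintro _ ⟨a, ha, rfl⟩ _ ⟨b, hb, rfl⟩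
  exact h a ha b hb

/-! ### Layer-cake formulas and the Prékopa–Leindler inequality on the line. -/

theorem lintegral_eq_lintegral_superlevel_of_le_one {α : Type*} [MeasurableSpace α]
    (μ : Measure α) {F : α → ENNReal} (hF : Measurable F) (hF1 : ∀ x, F x ≤ 1) :
    ∫⁻ x, F x ∂μ = ∫⁻ s in Set.Ioo (0 : ℝ) 1, μ {x | ENNReal.ofReal s < F x} := by
  have hfin : ∀ x, F x ≠ ⊤ := fun x => ((hF1 x).trans_lt ENNReal.one_lt_top).ne
  have h := lintegral_eq_lintegral_meas_lt μ (f := fun x => (F x).toReal)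
    (Filter.Eventually.of_forall fun x => ENNReal.toReal_nonneg) hF.ennreal_toReal.aemeasurable
  simp only [ENNReal.ofReal_toReal (hfin _)] at h
  rw [h, ← Set.Ioo_union_Ici_eq_Ioi (zero_lt_one' ℝ), lintegral_union measurableSet_Ici
    (Set.disjoint_left.2 fun x hx hx' => absurd hx.2 (not_lt.2 hx'))]
  have h0 : ∫⁻ s in Set.Ici (1 : ℝ), μ {x | s < (F x).toReal} = 0 := by
    rw [← lintegral_zero (μ := volume.restrict (Set.Ici (1 : ℝ)))]
    refine setLIntegral_congr_fun measurableSet_Ici fun s hs => ?_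
    have : {x | s < (F x).toReal} = ∅ := by
      refine Set.eq_empty_of_forall_notMem fun x hx => ?_
      have h2 := ENNReal.toReal_mono ENNReal.one_ne_top (hF1 x)
      simp only [Set.mem_ofPred_eq, Set.mem_Ici, ENNReal.toReal_one] at *
      linarith
    simp [this]
  rw [h0, add_zero]
  refine setLIntegral_congr_fun measurableSet_Ioo fun s hs => ?_
  simp only [ENNReal.ofReal_lt_iff_lt_toReal hs.1.le (hfin _)]

/-- Truncation of `F` at `1` does not change its superlevel sets below `1`. This serves the function
`H` of Prékopa–Leindler, which need not be bounded by `1`. -/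
theorem lintegral_superlevel_le {α : Type*} [MeasurableSpace α]
    (μ : Measure α) {F : α → ENNReal} (hF : Measurable F) :
    ∫⁻ s in Set.Ioo (0 : ℝ) 1, μ {x | ENNReal.ofReal s < F x} ≤ ∫⁻ x, F x ∂μ := by
  refine le_trans (le_of_eq ?_) (lintegral_mono (f := fun x => min (F x) 1) fun x => min_le_left _ _)
  rw [lintegral_eq_lintegral_superlevel_of_le_one μ (hF.min measurable_const)
    fun x => min_le_right _ _]
  refine setLIntegral_congr_fun measurableSet_Ioo fun s hs => ?_
  have : ENNReal.ofReal s < 1 := by simpa using hs.2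
  simp [this]

/-- The functional inequality of Prékopa and Leindler, as a property of a measure. -/
def IsPrekopaLeindler {E : Type*} [AddCommGroup E] [Module ℝ E] [MeasurableSpace E]
    (μ : Measure E) : Prop :=
  ∀ l ∈ Set.Ioo (0 : ℝ) 1, ∀ F G H : E → ENNReal, Measurable F → Measurable G → Measurable H →
    (∀ x y, F x ^ l * G y ^ (1 - l) ≤ H (l • x + (1 - l) • y)) →
    (∫⁻ x, F x ∂μ) ^ l * (∫⁻ x, G x ∂μ) ^ (1 - l) ≤ ∫⁻ x, H x ∂μ

theorem ENNReal.rpow_mul_rpow_le_add {l : ℝ} (hl : l ∈ Set.Ioo (0 : ℝ) 1) (a b : ENNReal) :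
    a ^ l * b ^ (1 - l) ≤ ENNReal.ofReal l * a + ENNReal.ofReal (1 - l) * b := by
  have h1 : 0 < 1 - l := sub_pos.2 hl.2
  have hl0 : ENNReal.ofReal l ≠ 0 := by simpa using hl.1
  have hl1 : ENNReal.ofReal (1 - l) ≠ 0 := by simpa using h1
  rcases eq_or_ne a ⊤ with rfl | ha
  · simp [ENNReal.mul_top hl0]
  rcases eq_or_ne b ⊤ with rfl | hb
  · simp [ENNReal.mul_top hl1]
  lift a to NNReal using ha
  lift b to NNReal using hb
  have := NNReal.geom_mean_le_arith_mean2_weighted ⟨l, hl.1.le⟩ ⟨1 - l, h1.le⟩ a b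
    (NNReal.eq (add_sub_cancel l 1))
  rw [← ENNReal.coe_rpow_of_nonneg _ hl.1.le, ← ENNReal.coe_rpow_of_nonneg _ h1.le,
    ENNReal.ofReal_eq_coe_nnreal hl.1.le, ENNReal.ofReal_eq_coe_nnreal h1.le]
  exact_mod_cast this

/-- Brunn–Minkowski is applied level by level: as `s = s ^ l * s ^ (1 - l)`, convex combinations of
the superlevel sets of `F` and `G` lie in that of `H`. Supremum `1` makes the sets of `F` and `G`
nonempty for every `s < 1`. Integration in `s` bounds even the arithmetic mean of the integrals. -/
theorem prekopaLeindler_of_iSup_eq_one {l : ℝ} (hl : l ∈ Set.Ioo (0 : ℝ) 1)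
    {F G H : ℝ → ENNReal} (hF : Measurable F) (hG : Measurable G) (hH : Measurable H)
    (hF1 : ⨆ x, F x = 1) (hG1 : ⨆ x, G x = 1)
    (h : ∀ x y, F x ^ l * G y ^ (1 - l) ≤ H (l * x + (1 - l) * y)) :
    (∫⁻ x, F x) ^ l * (∫⁻ x, G x) ^ (1 - l) ≤ ∫⁻ x, H x := by
  have h1 : 0 < 1 - l := sub_pos.2 hl.2
  refine (ENNReal.rpow_mul_rpow_le_add hl _ _).trans ?_
  rw [lintegral_eq_lintegral_superlevel_of_le_one _ hF fun x => hF1 ▸ le_iSup F x,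
    lintegral_eq_lintegral_superlevel_of_le_one _ hG fun x => hG1 ▸ le_iSup G x]
  have mono : ∀ K : ℝ → ENNReal, Measurable fun s : ℝ => volume {x | ENNReal.ofReal s < K x} :=
    fun K => Antitone.measurable fun s t hst => measure_mono fun x hx =>
      lt_of_le_of_lt (ENNReal.ofReal_le_ofReal hst) hx
  rw [← lintegral_const_mul _ (mono F), ← lintegral_const_mul _ (mono G),
    ← lintegral_add_left ((mono F).const_mul _)]
  refine le_trans (setLIntegral_mono (mono H) fun s hs => ?_) (lintegral_superlevel_le _ hH)
  have hs1 : ENNReal.ofReal s < 1 := by simpa using hs.2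
  have ne : ∀ K : ℝ → ENNReal, ⨆ x, K x = 1 → {x | ENNReal.ofReal s < K x}.Nonempty := by
    intro K hK
    obtain ⟨x, hx⟩ := lt_iSup_iff.1 (hK.symm ▸ hs1)
    exact ⟨x, hx⟩
  refine volume_convexComb_le hl (measurableSet_lt measurable_const hF)
    (measurableSet_lt measurable_const hG) (ne F hF1) (ne G hG1) fun x hx y hy => lt_of_lt_of_le ?_ (h x y)
  have e : ENNReal.ofReal s = ENNReal.ofReal s ^ l * ENNReal.ofReal s ^ (1 - l) := by
    rw [← ENNReal.rpow_add_of_nonneg _ _ hl.1.le h1.le]; simp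
  rw [e]
  exact ENNReal.mul_lt_mul (ENNReal.rpow_lt_rpow hx hl.1) (ENNReal.rpow_lt_rpow hy h1)

/-- The inequality is homogeneous, so `F` and `G` can be divided by their suprema, and `H` by the
matching geometric mean. -/
theorem prekopaLeindler_of_iSup_ne_top {l : ℝ} (hl : l ∈ Set.Ioo (0 : ℝ) 1)
    {F G H : ℝ → ENNReal} (hF : Measurable F) (hG : Measurable G) (hH : Measurable H)
    (hFt : ⨆ x, F x ≠ ⊤) (hGt : ⨆ x, G x ≠ ⊤)
    (h : ∀ x y, F x ^ l * G y ^ (1 - l) ≤ H (l * x + (1 - l) * y)) :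
    (∫⁻ x, F x) ^ l * (∫⁻ x, G x) ^ (1 - l) ≤ ∫⁻ x, H x := by
  have h1 : 0 < 1 - l := sub_pos.2 hl.2
  rcases eq_or_ne (⨆ x, F x) 0 with hF0 | hF0
  · have : ∀ x, F x = 0 := by simpa using hF0
    simp [this, hl.1]
  rcases eq_or_ne (⨆ x, G x) 0 with hG0 | hG0
  · have : ∀ x, G x = 0 := by simpa using hG0
    simp [this, h1]
  set a := ⨆ x, F x with ha
  set b := ⨆ x, G x with hb
  have ha' : a⁻¹ ≠ ⊤ := by simpa using hF0
  have hb' : b⁻¹ ≠ ⊤ := by simpa using hG0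
  have hal : (a⁻¹) ^ l ≠ ⊤ := ENNReal.rpow_ne_top_of_nonneg hl.1.le ha'
  have hbl : (b⁻¹) ^ (1 - l) ≠ ⊤ := ENNReal.rpow_ne_top_of_nonneg h1.le hb'
  have hal0 : (a⁻¹) ^ l ≠ 0 := by
    rw [ne_eq, ENNReal.rpow_eq_zero_iff_of_pos hl.1]; simpa using hFt
  have hbl0 : (b⁻¹) ^ (1 - l) ≠ 0 := by
    rw [ne_eq, ENNReal.rpow_eq_zero_iff_of_pos h1]; simpa using hGt
  have key := prekopaLeindler_of_iSup_eq_one hl (F := fun x => a⁻¹ * F x)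
    (G := fun x => b⁻¹ * G x) (H := fun x => (a⁻¹) ^ l * (b⁻¹) ^ (1 - l) * H x)
    (hF.const_mul _) (hG.const_mul _) (hH.const_mul _)
    (by rw [← ENNReal.mul_iSup, ENNReal.inv_mul_cancel hF0 hFt])
    (by rw [← ENNReal.mul_iSup, ENNReal.inv_mul_cancel hG0 hGt])
    (fun x y => by
      rw [ENNReal.mul_rpow_of_nonneg _ _ hl.1.le, ENNReal.mul_rpow_of_nonneg _ _ h1.le,
        mul_mul_mul_comm]
      gcongr
      exact h x y)
  rw [lintegral_const_mul _ hF, lintegral_const_mul _ hG, lintegral_const_mul _ hH,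
    ENNReal.mul_rpow_of_nonneg _ _ hl.1.le, ENNReal.mul_rpow_of_nonneg _ _ h1.le,
    mul_mul_mul_comm] at key
  exact (ENNReal.mul_le_mul_iff_right (mul_ne_zero hal0 hbl0) (ENNReal.mul_ne_top hal hbl)).1 key

/-- The Prékopa–Leindler inequality on the line. -/
theorem isPrekopaLeindler_volume_real : IsPrekopaLeindler (volume : Measure ℝ) := by
  intro l hl F G H hF hG hH h
  have h1 : 0 < 1 - l := sub_pos.2 hl.2
  have trunc : ∀ K : ℝ → ENNReal, Measurable K →
      ∫⁻ x, K x = ⨆ n : ℕ, ∫⁻ x, min (K x) n := by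
    intro K hK
    rw [← lintegral_iSup (fun n => hK.min measurable_const)
      fun m n hmn x => min_le_min le_rfl (by exact_mod_cast hmn)]
    refine lintegral_congr fun x => ?_
    rw [← inf_iSup_eq, ENNReal.iSup_natCast]
    simp
  have hbd : ∀ (K : ℝ → ENNReal) (n : ℕ), ⨆ x, min (K x) n ≠ ⊤ := fun K n =>
    ((iSup_le fun x => min_le_right (K x) (n : ENNReal)).trans_lt (ENNReal.natCast_lt_top n)).ne
  rw [trunc F hF, trunc G hG]
  -- A positive power is an order isomorphism of `[0, ∞]`, so it commutes with the suprema over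
  -- truncations.
  have e1 := (ENNReal.orderIsoRpow l hl.1).map_iSup fun n : ℕ => ∫⁻ x, min (F x) n
  have e2 := (ENNReal.orderIsoRpow (1 - l) h1).map_iSup fun n : ℕ => ∫⁻ x, min (G x) n
  simp only [ENNReal.orderIsoRpow_apply] at e1 e2
  rw [e1, e2, ENNReal.iSup_mul]
  refine iSup_le fun m => ?_
  rw [ENNReal.mul_iSup]
  refine iSup_le fun n => ?_
  refine prekopaLeindler_of_iSup_ne_top hl (hF.min measurable_const) (hG.min measurable_const) hH
    (hbd F m) (hbd G n) fun x y => le_trans ?_ (h x y)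
  exact mul_le_mul' (ENNReal.rpow_le_rpow (min_le_left _ _) hl.1.le)
    (ENNReal.rpow_le_rpow (min_le_left _ _) h1.le)

/-! ### Stability of Prékopa–Leindler under densities, products and linear maps. -/

theorem IsPrekopaLeindler.withDensity {E : Type*} [AddCommGroup E] [Module ℝ E]
    [MeasurableSpace E] {μ : Measure E} (hμ : IsPrekopaLeindler μ) {d : E → ENNReal}
    (hd : Measurable d)
    (hlc : ∀ l ∈ Set.Ioo (0 : ℝ) 1, ∀ x y, d x ^ l * d y ^ (1 - l) ≤ d (l • x + (1 - l) • y)) :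
    IsPrekopaLeindler (μ.withDensity d) := by
  intro l hl F G H hF hG hH h
  have h1 : 0 < 1 - l := sub_pos.2 hl.2
  simp only [lintegral_withDensity_eq_lintegral_mul _ hd hF,
    lintegral_withDensity_eq_lintegral_mul _ hd hG, lintegral_withDensity_eq_lintegral_mul _ hd hH]
  refine hμ l hl _ _ _ (hd.mul hF) (hd.mul hG) (hd.mul hH) fun x y => ?_
  simp only [Pi.mul_apply]
  rw [ENNReal.mul_rpow_of_nonneg _ _ hl.1.le, ENNReal.mul_rpow_of_nonneg _ _ h1.le,
    mul_mul_mul_comm]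
  exact mul_le_mul' (hlc l hl x y) (h x y)

/-- The inequality for `ν` on fibres is exactly the hypothesis for `μ` on the partial integrals. -/
theorem IsPrekopaLeindler.prod {E E' : Type*} [AddCommGroup E] [Module ℝ E] [MeasurableSpace E]
    [AddCommGroup E'] [Module ℝ E'] [MeasurableSpace E'] {μ : Measure E} {ν : Measure E'}
    [SFinite ν] (hμ : IsPrekopaLeindler μ) (hν : IsPrekopaLeindler ν) :
    IsPrekopaLeindler (μ.prod ν) := by
  intro l hl F G H hF hG hH h
  rw [lintegral_prod _ hF.aemeasurable, lintegral_prod _ hG.aemeasurable,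
    lintegral_prod _ hH.aemeasurable]
  refine hμ l hl _ _ _ hF.lintegral_prod_right' hG.lintegral_prod_right'
    hH.lintegral_prod_right' fun x y => ?_
  exact hν l hl _ _ _ (hF.comp measurable_prodMk_left) (hG.comp measurable_prodMk_left)
    (hH.comp measurable_prodMk_left) fun u v => h (x, u) (y, v)

theorem IsPrekopaLeindler.map {E E' : Type*} [AddCommGroup E] [Module ℝ E] [MeasurableSpace E]
    [AddCommGroup E'] [Module ℝ E'] [MeasurableSpace E'] {μ : Measure E}
    (hμ : IsPrekopaLeindler μ) (e : E →ₗ[ℝ] E') (he : Measurable e) :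
    IsPrekopaLeindler (μ.map e) := by
  intro l hl F G H hF hG hH h
  rw [lintegral_map hF he, lintegral_map hG he, lintegral_map hH he]
  refine hμ l hl _ _ _ (hF.comp he) (hG.comp he) (hH.comp he) fun x y => ?_
  simpa using h (e x) (e y)

theorem isPrekopaLeindler_dirac {E : Type*} [AddCommGroup E] [Module ℝ E] [MeasurableSpace E]
    (a : E) : IsPrekopaLeindler (Measure.dirac a) := by
  intro l hl F G H hF hG hH h
  rw [lintegral_dirac' _ hF, lintegral_dirac' _ hG, lintegral_dirac' _ hH]
  simpa [← add_smul] using h a a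

theorem IsPrekopaLeindler.pi {μ : Measure ℝ} [SigmaFinite μ] (hμ : IsPrekopaLeindler μ) (n : ℕ) :
    IsPrekopaLeindler (Measure.pi fun _ : Fin n => μ) := by
  induction n with
  | zero =>
    rw [Measure.pi_of_empty]
    exact isPrekopaLeindler_dirac _
  | succ n ih =>
    have hp := (measurePreserving_piFinSuccAbove (fun _ : Fin (n + 1) => μ) 0).symm
    let e : ℝ × (Fin n → ℝ) →ₗ[ℝ] (Fin (n + 1) → ℝ) :=
      { toFun := fun p => Fin.cons p.1 p.2
        map_add' := fun p q => by
          ext i; refine Fin.cases ?_ (fun j => ?_) i <;> simp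
        map_smul' := fun c p => by
          ext i; refine Fin.cases ?_ (fun j => ?_) i <;> simp }
    have he : ⇑(MeasurableEquiv.piFinSuccAbove (fun _ : Fin (n + 1) => ℝ) 0).symm = ⇑e := by
      ext p i
      simp [e, MeasurableEquiv.piFinSuccAbove, Fin.insertNthEquiv]
    rw [← hp.map_eq, he]
    exact (hμ.prod ih).map e (he ▸ MeasurableEquiv.measurable _)

/-! ### Joint convexity of `φ u * ψ v`. -/

theorem quadratic_form_nonneg {A B C : ℝ} (hA : 0 ≤ A) (hC : 0 ≤ C) (h : B ^ 2 ≤ A * C)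
    (p q : ℝ) : 0 ≤ p ^ 2 * A + 2 * (p * q * B) + q ^ 2 * C := by
  have h1 : (2 * (p * q * B)) ^ 2 ≤ (p ^ 2 * A + q ^ 2 * C) ^ 2 := by
    have := mul_le_mul_of_nonneg_left h (by positivity : 0 ≤ 4 * (p * q) ^ 2)
    nlinarith [sq_nonneg (p ^ 2 * A - q ^ 2 * C)]
  have := neg_abs_le (2 * (p * q * B))
  have := abs_le_of_sq_le_sq h1 (by positivity)
  linarith

/-- A product `φ u * ψ v` is jointly convex if its Hessian is positive semidefinite. -/
theorem convexOn_mul_of_hasDerivAt2 {I J : Set ℝ} (hI : I.OrdConnected) (hJ : J.OrdConnected)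
    {φ φ' φ'' ψ ψ' ψ'' : ℝ → ℝ} (hφc : ContinuousOn φ I) (hψc : ContinuousOn ψ J)
    (hφ0 : ∀ u ∈ I, 0 ≤ φ u) (hψ0 : ∀ v ∈ J, 0 ≤ ψ v)
    (hφ1 : ∀ u ∈ interior I, HasDerivAt φ (φ' u) u)
    (hφ2 : ∀ u ∈ interior I, HasDerivAt φ' (φ'' u) u)
    (hψ1 : ∀ v ∈ interior J, HasDerivAt ψ (ψ' v) v)
    (hψ2 : ∀ v ∈ interior J, HasDerivAt ψ' (ψ'' v) v)
    (hφ'' : ∀ u ∈ interior I, 0 ≤ φ'' u) (hψ'' : ∀ v ∈ interior J, 0 ≤ ψ'' v)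
    (h : ∀ u ∈ interior I, ∀ v ∈ interior J, (φ' u * ψ' v) ^ 2 ≤ φ'' u * ψ'' v * φ u * ψ v) :
    ConvexOn ℝ (I ×ˢ J) fun p : ℝ × ℝ => φ p.1 * ψ p.2 := by
  have hφ : ConvexOn ℝ I φ := convexOn_of_hasDerivWithinAt2_nonneg hI.convex hφc
    (fun u hu => (hφ1 u hu).hasDerivWithinAt) (fun u hu => (hφ2 u hu).hasDerivWithinAt) hφ''
  have hψ : ConvexOn ℝ J ψ := convexOn_of_hasDerivWithinAt2_nonneg hJ.convex hψc
    (fun u hu => (hψ1 u hu).hasDerivWithinAt) (fun u hu => (hψ2 u hu).hasDerivWithinAt) hψ''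
  refine ⟨hI.convex.prod hJ.convex, ?_⟩
  rintro ⟨u₀, v₀⟩ ⟨hu₀, hv₀⟩ ⟨u₁, v₁⟩ ⟨hu₁, hv₁⟩ a b ha hb hab
  simp only [Prod.smul_mk, Prod.mk_add_mk, smul_eq_mul] at *
  -- A segment with a constant coordinate may lie on the boundary, where no derivatives are given;
  -- convexity in the other variable settles it. Any other open segment has both coordinates in the
  -- interiors.
  rcases eq_or_ne u₀ u₁ with rfl | hu
  · have h1 := hψ.2 hv₀ hv₁ ha hb hab
    simp only [smul_eq_mul] at h1
    rw [← add_mul, hab, one_mul]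
    nlinarith [mul_le_mul_of_nonneg_left h1 (hφ0 u₀ hu₀)]
  rcases eq_or_ne v₀ v₁ with rfl | hv
  · have h1 := hφ.2 hu₀ hu₁ ha hb hab
    simp only [smul_eq_mul] at h1
    rw [← add_mul, hab, one_mul]
    nlinarith [mul_le_mul_of_nonneg_left h1 (hψ0 v₀ hv₀)]
  let U : ℝ → ℝ := fun s => (1 - s) * u₀ + s * u₁
  let V : ℝ → ℝ := fun s => (1 - s) * v₀ + s * v₁
  have hUI : ∀ s ∈ Set.Icc (0 : ℝ) 1, U s ∈ I := fun s hs =>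
    hI.convex hu₀ hu₁ (sub_nonneg.2 hs.2) hs.1 (sub_add_cancel 1 s)
  have hVJ : ∀ s ∈ Set.Icc (0 : ℝ) 1, V s ∈ J := fun s hs =>
    hJ.convex hv₀ hv₁ (sub_nonneg.2 hs.2) hs.1 (sub_add_cancel 1 s)
  have hUI' : ∀ s ∈ Set.Ioo (0 : ℝ) 1, U s ∈ interior I := fun s hs =>
    hI.strictConvex hu₀ hu₁ hu (sub_pos.2 hs.2) hs.1 (sub_add_cancel 1 s)
  have hVJ' : ∀ s ∈ Set.Ioo (0 : ℝ) 1, V s ∈ interior J := fun s hs =>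
    hJ.strictConvex hv₀ hv₁ hv (sub_pos.2 hs.2) hs.1 (sub_add_cancel 1 s)
  have hU : ∀ s, HasDerivAt U (u₁ - u₀) s := fun s =>
    ((((hasDerivAt_id s).const_sub 1).mul_const u₀).add
      ((hasDerivAt_id s).mul_const u₁)).congr_deriv (by ring)
  have hV : ∀ s, HasDerivAt V (v₁ - v₀) s := fun s =>
    ((((hasDerivAt_id s).const_sub 1).mul_const v₀).add
      ((hasDerivAt_id s).mul_const v₁)).congr_deriv (by ring)
  have hUc : Continuous U := continuous_iff_continuousAt.2 fun s => (hU s).continuousAt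
  have hVc : Continuous V := continuous_iff_continuousAt.2 fun s => (hV s).continuousAt
  have key : ConvexOn ℝ (Set.Icc (0 : ℝ) 1) fun s => φ (U s) * ψ (V s) := by
    refine convexOn_of_hasDerivWithinAt2_nonneg (convex_Icc 0 1)
      (f' := fun s => φ' (U s) * (u₁ - u₀) * ψ (V s) + φ (U s) * (ψ' (V s) * (v₁ - v₀)))
      (f'' := fun s => (φ'' (U s) * (u₁ - u₀) * (u₁ - u₀) * ψ (V s)
        + φ' (U s) * (u₁ - u₀) * (ψ' (V s) * (v₁ - v₀)))
        + (φ' (U s) * (u₁ - u₀) * (ψ' (V s) * (v₁ - v₀))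
        + φ (U s) * (ψ'' (V s) * (v₁ - v₀) * (v₁ - v₀))))
      ((hφc.comp hUc.continuousOn hUI).mul (hψc.comp hVc.continuousOn hVJ)) ?_ ?_ ?_
    all_goals
      rw [interior_Icc]
      intro s hs
      have hs' := Set.Ioo_subset_Icc_self hs
      have d1 : HasDerivAt (fun s => φ (U s)) _ s := (hφ1 _ (hUI' s hs)).comp s (hU s)
      have d2 : HasDerivAt (fun s => φ' (U s)) _ s := (hφ2 _ (hUI' s hs)).comp s (hU s)
      have d3 : HasDerivAt (fun s => ψ (V s)) _ s := (hψ1 _ (hVJ' s hs)).comp s (hV s)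
      have d4 : HasDerivAt (fun s => ψ' (V s)) _ s := (hψ2 _ (hVJ' s hs)).comp s (hV s)
    · exact (d1.mul d3).hasDerivWithinAt
    · exact (((d2.mul_const _).mul d3).add (d1.mul (d4.mul_const _))).hasDerivWithinAt
    -- The second derivative along the segment is the Hessian form at `(u₁ - u₀, v₁ - v₀)`.
    · have h1 := quadratic_form_nonneg
        (mul_nonneg (hφ'' _ (hUI' s hs)) (hψ0 _ (hVJ s hs')))
        (mul_nonneg (hφ0 _ (hUI s hs')) (hψ'' _ (hVJ' s hs)))
        ((h _ (hUI' s hs) _ (hVJ' s hs)).trans_eq (by ring)) (u₁ - u₀) (v₁ - v₀)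
      linarith
  have h1 := key.2 (Set.left_mem_Icc.2 zero_le_one) (Set.right_mem_Icc.2 zero_le_one) ha hb hab
  have ea : a = 1 - b := by linarith
  simpa [U, V, ea] using h1

theorem uniqueDiffOn_of_ordConnected {I : Set ℝ} (hI : I.OrdConnected) (hI' : I.Nontrivial) :
    UniqueDiffOn ℝ I := by
  obtain ⟨a, ha, b, hb, hab⟩ := hI'.exists_lt
  refine uniqueDiffOn_convex hI.convex ⟨(a + b) / 2, interior_maximal
    (Set.Ioo_subset_Icc_self.trans (hI.out ha hb)) isOpen_Ioo ⟨by linarith, by linarith⟩⟩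

theorem ContDiffOn.hasDerivAt_derivWithin {I : Set ℝ} {φ : ℝ → ℝ} (hφ : ContDiffOn ℝ 2 φ I)
    {u : ℝ} (hu : u ∈ interior I) : HasDerivAt φ (derivWithin φ I u) u :=
  ((hφ.differentiableOn (by norm_num) u (interior_subset hu)).hasDerivWithinAt).hasDerivAt
    (mem_interior_iff_mem_nhds.1 hu)

theorem ContDiffOn.hasDerivAt_iteratedDerivWithin_two {I : Set ℝ} (hI : UniqueDiffOn ℝ I)
    {φ : ℝ → ℝ} (hφ : ContDiffOn ℝ 2 φ I) {u : ℝ} (hu : u ∈ interior I) :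
    HasDerivAt (derivWithin φ I) (iteratedDerivWithin 2 φ I u) u := by
  have h := hφ.differentiableOn_iteratedDerivWithin (m := 1) (by norm_num) hI u (interior_subset hu)
  rw [iteratedDerivWithin_succ]
  simp only [iteratedDerivWithin_one] at h ⊢
  exact h.hasDerivWithinAt.hasDerivAt (mem_interior_iff_mem_nhds.1 hu)

/-- The point is to derive `ψ'' ≥ 0`, which is not assumed. Injectivity of `φ` and the mean value
theorem give `c` with `φ' c ≠ 0`. If `ψ'' v < 0`, then `ψ'' < 0` near `v`, and the inequality at `c`
forces `ψ' = 0` there, so `ψ'' v = 0`. -/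
theorem convexOn_mul_of_iteratedDerivWithin {I J : Set ℝ} (hI : I.OrdConnected)
    (hJ : J.OrdConnected) (hI_nt : I.Nontrivial) (hJ_nt : J.Nontrivial) {φ ψ : ℝ → ℝ}
    (hφ0 : ∀ u ∈ I, 0 ≤ φ u) (hψ0 : ∀ v ∈ J, 0 ≤ ψ v)
    (hφ_C2 : ContDiffOn ℝ 2 φ I) (hψ_C2 : ContDiffOn ℝ 2 ψ J) (hφ_inj : Set.InjOn φ I)
    (hφ_conv : ∀ u ∈ I, 0 ≤ iteratedDerivWithin 2 φ I u)
    (h : ∀ u ∈ I, ∀ v ∈ J, (derivWithin φ I u * derivWithin ψ J v) ^ 2 ≤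
      iteratedDerivWithin 2 φ I u * iteratedDerivWithin 2 ψ J v * φ u * ψ v) :
    ConvexOn ℝ (I ×ˢ J) fun p : ℝ × ℝ => φ p.1 * ψ p.2 := by
  have hIu := uniqueDiffOn_of_ordConnected hI hI_nt
  have hJu := uniqueDiffOn_of_ordConnected hJ hJ_nt
  obtain ⟨a, ha, b, hb, hab⟩ := hI_nt.exists_lt
  have hIab : Set.Icc a b ⊆ I := hI.out ha hb
  have hIab' : Set.Ioo a b ⊆ interior I :=
    interior_maximal (Set.Ioo_subset_Icc_self.trans hIab) isOpen_Ioo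
  obtain ⟨c, hc, hc'⟩ := exists_hasDerivAt_eq_slope φ (derivWithin φ I) hab
    (hφ_C2.continuousOn.mono hIab) fun x hx => hφ_C2.hasDerivAt_derivWithin (hIab' hx)
  have hc0 : derivWithin φ I c ≠ 0 := by
    rw [hc']
    exact div_ne_zero (sub_ne_zero.2 fun e => hab.ne' (hφ_inj hb ha e)) (sub_ne_zero.2 hab.ne')
  have hcI : c ∈ I := interior_subset (hIab' hc)
  refine convexOn_mul_of_hasDerivAt2 hI hJ hφ_C2.continuousOn hψ_C2.continuousOn hφ0 hψ0
    (fun u hu => hφ_C2.hasDerivAt_derivWithin hu)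
    (fun u hu => hφ_C2.hasDerivAt_iteratedDerivWithin_two hIu hu)
    (fun u hu => hψ_C2.hasDerivAt_derivWithin hu)
    (fun u hu => hψ_C2.hasDerivAt_iteratedDerivWithin_two hJu hu)
    (fun u hu => hφ_conv u (interior_subset hu)) ?_
    (fun u hu v hv => h u (interior_subset hu) v (interior_subset hv))
  intro v hv
  by_contra! hneg
  have hcont : ContinuousAt (iteratedDerivWithin 2 ψ J) v :=
    (hψ_C2.continuousOn_iteratedDerivWithin (m := 2) le_rfl hJu).continuousAt
      (mem_interior_iff_mem_nhds.1 hv)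
  have hzero : derivWithin ψ J =ᶠ[nhds v] fun _ => 0 := by
    filter_upwards [hcont.eventually_lt continuousAt_const hneg,
      mem_interior_iff_mem_nhds.1 hv] with w hw hwJ
    have h1 : (derivWithin φ I c * derivWithin ψ J w) ^ 2 ≤ 0 := by
      refine (h c hcI w hwJ).trans ?_
      have h2 := mul_nonneg (mul_nonneg (hφ_conv c hcI) (hφ0 c hcI)) (hψ0 w hwJ)
      nlinarith
    have h2 : derivWithin φ I c * derivWithin ψ J w = 0 :=
      pow_eq_zero_iff two_ne_zero |>.1 (le_antisymm h1 (sq_nonneg _))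
    exact (mul_eq_zero.1 h2).resolve_left hc0
  have := (hψ_C2.hasDerivAt_iteratedDerivWithin_two hJu hv).unique
    ((hasDerivAt_const v (0 : ℝ)).congr_of_eventuallyEq hzero)
  exact hneg.ne this

/-! ### Weak majorization tested against nonnegative weights. -/

/-- Abel summation by induction: `c 0` multiplies the total of `d`, and the remaining weights `c
i.succ - c 0` are again monotone and nonnegative. -/
theorem sum_mul_nonneg_of_monotone {n : ℕ} {c d : Fin n → ℝ} (hc : Monotone c)
    (hc0 : ∀ i, 0 ≤ c i) (hd : ∀ j, 0 ≤ ∑ i ∈ Finset.Ici j, d i) : 0 ≤ ∑ i, c i * d i := by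
  induction n with
  | zero => simp
  | succ n ih =>
    have h1 := ih (c := fun i => c i.succ - c 0) (d := fun i => d i.succ)
      (fun i j hij => sub_le_sub_right (hc (Fin.succ_le_succ_iff.2 hij)) _)
      (fun i => sub_nonneg.2 (hc (Fin.zero_le _))) fun j => by
        have := hd j.succ
        rwa [← Fin.map_succEmb_Ici, Finset.sum_map] at this
    have h2 : 0 ≤ ∑ i, d i := by
      have := hd 0
      rwa [show Finset.Ici (0 : Fin (n + 1)) = Finset.univ by ext; simp] at this
    have h3 := mul_nonneg (hc0 0) h2
    simp only [sub_mul, Finset.sum_sub_distrib, ← Finset.mul_sum] at h1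
    rw [Fin.sum_univ_succ] at h3 ⊢
    linarith

theorem sum_mul_nonneg_of_antitone {n : ℕ} {c d : Fin n → ℝ} (hc : Antitone c)
    (hc0 : ∀ i, 0 ≤ c i) (hd : ∀ j, 0 ≤ ∑ i ∈ Finset.Iic j, d i) : 0 ≤ ∑ i, c i * d i := by
  rw [← Equiv.sum_comp Fin.revPerm]
  refine sum_mul_nonneg_of_monotone (c := c ∘ Fin.revPerm) (d := d ∘ Fin.revPerm)
    (fun i j hij => hc (Fin.rev_le_rev.2 hij)) (fun i => hc0 _) fun j => ?_
  have := hd j.rev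
  rw [← Fin.map_revPerm_Ici, Finset.sum_map] at this
  exact this

theorem incrArr_monotone {n : ℕ} (x : Fin n → ℝ) : Monotone (incrArr x) := Tuple.monotone_sort x

theorem sum_mul_comp_eq_sum_mul_incrArr {n : ℕ} (c y : Fin n → ℝ) (τ : Equiv.Perm (Fin n)) :
    ∑ i, c i * y i = ∑ i, c (τ i) * incrArr y (((Tuple.sort y)⁻¹ * τ) i) := by
  rw [← Equiv.sum_comp τ]
  simp [incrArr]

theorem sum_mul_incrArr_eq {n : ℕ} (c x : Fin n → ℝ) (τ : Equiv.Perm (Fin n)) :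
    ∑ i, c (τ i) * incrArr x i = ∑ i, c i * x ((Tuple.sort x * τ⁻¹) i) := by
  rw [← Equiv.sum_comp τ (fun i => c i * x ((Tuple.sort x * τ⁻¹) i))]
  simp [incrArr]

/-- By rearrangement, the sum for `y` is largest when `c` and `y` are sorted alike; Abel summation
then compares sorted `y` with sorted `x`. This is the input that contradicts a separating
functional. -/
theorem SubmajorizedBy.exists_perm {n : ℕ} {x y : Fin n → ℝ} (h : SubmajorizedBy y x)
    {c : Fin n → ℝ} (hc : ∀ i, 0 ≤ c i) :
    ∃ σ : Equiv.Perm (Fin n), ∑ i, c i * y i ≤ ∑ i, c i * x (σ i) := by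
  have hm : Monotone (c ∘ Tuple.sort c) := Tuple.monotone_sort c
  refine ⟨Tuple.sort x * (Tuple.sort c)⁻¹, ?_⟩
  rw [sum_mul_comp_eq_sum_mul_incrArr c y (Tuple.sort c), ← sum_mul_incrArr_eq]
  refine (Monovary.sum_mul_comp_perm_le_sum_mul (f := c ∘ Tuple.sort c)
    (hm.monovary (incrArr_monotone y))).trans ?_
  have := sum_mul_nonneg_of_monotone (d := fun i => incrArr x i - incrArr y i) hm
    (fun i => hc _) fun j => by
      rw [Finset.sum_sub_distrib]
      exact sub_nonneg.2 (h j)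
  simp only [mul_sub, Finset.sum_sub_distrib] at this
  exact sub_nonneg.1 this

theorem SupmajorizedBy.exists_perm {n : ℕ} {x y : Fin n → ℝ} (h : SupmajorizedBy y x)
    {c : Fin n → ℝ} (hc : ∀ i, 0 ≤ c i) :
    ∃ σ : Equiv.Perm (Fin n), ∑ i, c i * x (σ i) ≤ ∑ i, c i * y i := by
  -- Sorting `-c` puts `c` in decreasing order, so that the largest weights meet the smallest
  -- components.
  set τ := Tuple.sort (-c) with hτ
  have hm : Antitone (c ∘ τ) := fun i j hij => neg_le_neg_iff.1 (Tuple.monotone_sort (-c) hij)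
  refine ⟨Tuple.sort x * τ⁻¹, ?_⟩
  rw [sum_mul_comp_eq_sum_mul_incrArr c y τ, ← sum_mul_incrArr_eq]
  refine le_trans ?_ (Antivary.sum_mul_le_sum_mul_comp_perm (f := c ∘ τ)
    (hm.antivary (incrArr_monotone y)))
  have := sum_mul_nonneg_of_antitone (d := fun i => incrArr y i - incrArr x i) hm
    (fun i => hc _) fun j => by
      rw [Finset.sum_sub_distrib]
      exact sub_nonneg.2 (h j)
  simp only [mul_sub, Finset.sum_sub_distrib] at this
  exact sub_nonneg.1 this

theorem MajorizedBy.supmajorizedBy {n : ℕ} {x y : Fin n → ℝ} (h : MajorizedBy x y) :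
    SupmajorizedBy x y := h.2

/-- A tail sum is the total minus an initial sum, and the totals agree. -/
theorem MajorizedBy.submajorizedBy {n : ℕ} {x y : Fin n → ℝ} (h : MajorizedBy x y) :
    SubmajorizedBy x y := by
  intro j
  have hsplit : ∀ z : Fin n → ℝ, ∑ i, z i = ∑ i ∈ Finset.Iio j, z i + ∑ i ∈ Finset.Ici j, z i := by
    intro z
    rw [← Finset.sum_union (Finset.disjoint_left.2 fun i hi hi' => by simp at hi hi'; omega)]
    congr 1
    ext i
    simpa using lt_or_ge i j
  have hpre : ∑ i ∈ Finset.Iio j, incrArr y i ≤ ∑ i ∈ Finset.Iio j, incrArr x i := by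
    by_cases hj : j.val = 0
    · rw [show Finset.Iio j = ∅ by ext i; simp [Fin.lt_def, hj]]
      simp
    · have e : Finset.Iio j = Finset.Iic ⟨j.val - 1, by omega⟩ := by
        ext i
        simp only [Finset.mem_Iio, Finset.mem_Iic, Fin.lt_def, Fin.le_def]
        omega
      rw [e]
      exact h.2 _
  have := h.1
  rw [hsplit, hsplit] at this
  linarith

/-! ### The permutohedron and weak majorization. -/

/-- The convex hull of all rearrangements of `x`. -/
def permutohedron {n : ℕ} (x : Fin n → ℝ) : Set (Fin n → ℝ) :=
  convexHull ℝ (Set.range fun σ : Equiv.Perm (Fin n) => x ∘ σ)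

theorem isCompact_permutohedron {n : ℕ} (x : Fin n → ℝ) : IsCompact (permutohedron x) :=
  (Set.finite_range _).isCompact_convexHull ℝ

theorem comp_mem_permutohedron {n : ℕ} (x : Fin n → ℝ) (σ : Equiv.Perm (Fin n)) :
    x ∘ σ ∈ permutohedron x := subset_convexHull _ _ ⟨σ, rfl⟩

theorem ContinuousLinearMap.apply_eq_sum_single {n : ℕ} (f : (Fin n → ℝ) →L[ℝ] ℝ)
    (x : Fin n → ℝ) : f x = ∑ i, f (Pi.single i 1) * x i := by
  conv_lhs => rw [pi_eq_sum_univ' x, map_sum]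
  refine Finset.sum_congr rfl fun i _ => ?_
  rw [map_smul, smul_eq_mul, mul_comm]

theorem nonneg_of_forall_lt_add_mul {u a c : ℝ} (h : ∀ s, 0 ≤ s → u < a + s * c) : 0 ≤ c := by
  by_contra! hc
  have h0 := h 0 le_rfl
  -- At this `s` the affine function `a + s * c` takes the value `u`.
  have h1 := h ((a - u) / (-c)) (div_nonneg (by linarith) (by linarith))
  have h2 : (a - u) / (-c) * c = -(a - u) := by
    rw [div_neg, neg_mul, div_mul_cancel₀ _ hc.ne]
  linarith

/-- Otherwise a functional strictly separates the permutohedron from the orthant above `y`. Being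
bounded below on that orthant, it has nonnegative coefficients, which contradicts
`SubmajorizedBy.exists_perm`. -/
theorem SubmajorizedBy.exists_le_mem_permutohedron {n : ℕ} {x y : Fin n → ℝ}
    (h : SubmajorizedBy y x) : ∃ z ∈ permutohedron x, y ≤ z := by
  by_contra! hne
  obtain ⟨f, u, v, hu, huv, hv⟩ := geometric_hahn_banach_compact_closed
    (convex_convexHull ℝ _) (isCompact_permutohedron x) (convex_Ici y) isClosed_Ici
    (Set.disjoint_left.2 fun z hz hz' => hne z hz hz')
  have hc : ∀ i, 0 ≤ f (Pi.single i 1) := fun i => by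
    refine nonneg_of_forall_lt_add_mul (u := v) (a := f y) fun s hs => ?_
    have h1 : y ≤ y + s • Pi.single i (1 : ℝ) :=
      le_add_of_nonneg_right (smul_nonneg hs (Pi.single_nonneg.2 zero_le_one))
    simpa using hv _ h1
  obtain ⟨σ, hσ⟩ := h.exists_perm hc
  have h1 := hu _ (comp_mem_permutohedron x σ)
  have h2 := hv y (Set.mem_Ici.2 le_rfl)
  rw [f.apply_eq_sum_single] at h1 h2
  simp only [Function.comp_apply] at h1
  linarith

theorem SupmajorizedBy.exists_mem_permutohedron_le {n : ℕ} {x y : Fin n → ℝ}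
    (h : SupmajorizedBy y x) : ∃ z ∈ permutohedron x, z ≤ y := by
  by_contra! hne
  obtain ⟨f, u, v, hu, huv, hv⟩ := geometric_hahn_banach_closed_compact
    (convex_Iic y) isClosed_Iic (convex_convexHull ℝ _) (isCompact_permutohedron x)
    (Set.disjoint_left.2 fun z hz hz' => hne z hz' hz)
  have hc : ∀ i, 0 ≤ f (Pi.single i 1) := fun i => by
    refine nonneg_of_forall_lt_add_mul (u := -u) (a := -f y) fun s hs => ?_
    have h1 : y - s • Pi.single i (1 : ℝ) ≤ y :=
      sub_le_self _ (smul_nonneg hs (Pi.single_nonneg.2 zero_le_one))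
    have h2 := hu _ h1
    simp only [map_sub, map_smul, smul_eq_mul] at h2
    linarith
  obtain ⟨σ, hσ⟩ := h.exists_perm hc
  have h1 := hv _ (comp_mem_permutohedron x σ)
  have h2 := hu y (Set.mem_Iic.2 le_rfl)
  rw [f.apply_eq_sum_single] at h1 h2
  simp only [Function.comp_apply] at h1
  linarith

theorem permutohedron_subset_pi {n : ℕ} {x : Fin n → ℝ} {I : Set ℝ} (hI : Convex ℝ I)
    (hx : ∀ i, x i ∈ I) {z : Fin n → ℝ} (hz : z ∈ permutohedron x) (i : Fin n) : z i ∈ I := by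
  have h : permutohedron x ⊆ Set.univ.pi fun _ => I :=
    convexHull_min (by rintro _ ⟨σ, rfl⟩ i -; exact hx _) (convex_pi fun _ _ => hI)
  exact h hz i trivial

/-! ### Measures of the sublevel sets. -/

theorem isPrekopaLeindler_withDensity_of_logConcaveOn {f : ℝ → ℝ} (hfm : Measurable f)
    (hf0 : ∀ x, 0 ≤ f x) (hf : LogConcaveOn Set.univ f) :
    IsPrekopaLeindler (volume.withDensity fun x => ENNReal.ofReal (f x)) := by
  refine isPrekopaLeindler_volume_real.withDensity hfm.ennreal_ofReal fun l hl x y => ?_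
  rw [ENNReal.ofReal_rpow_of_nonneg (hf0 x) hl.1.le,
    ENNReal.ofReal_rpow_of_nonneg (hf0 y) (sub_nonneg.2 hl.2.le),
    ← ENNReal.ofReal_mul (Real.rpow_nonneg (hf0 x) _)]
  exact ENNReal.ofReal_le_ofReal (hf.2 x trivial y trivial l ⟨hl.1.le, hl.2.le⟩)

/-- The part of `J ^ n` on which `∑ φ (x i) * ψ (v i)` is at most `t`. -/
def mulSublevel {n : ℕ} (J : Set ℝ) (φ ψ : ℝ → ℝ) (t : ℝ) (x : Fin n → ℝ) : Set (Fin n → ℝ) :=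
  {v | (∀ i, v i ∈ J) ∧ ∑ i, φ (x i) * ψ (v i) ≤ t}

theorem measurableSet_mulSublevel {n : ℕ} {J : Set ℝ} (hJ : MeasurableSet J) (φ : ℝ → ℝ)
    {ψ : ℝ → ℝ} (hψ : Measurable ψ) (t : ℝ) (x : Fin n → ℝ) :
    MeasurableSet (mulSublevel J φ ψ t x) := by
  have h1 : MeasurableSet (⋂ i, (fun v : Fin n → ℝ => v i) ⁻¹' J) :=
    MeasurableSet.iInter fun i => measurable_pi_apply i hJ
  have h2 : Measurable fun v : Fin n → ℝ => ∑ i, φ (x i) * ψ (v i) :=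
    Finset.measurable_sum _ fun i _ => (hψ.comp (measurable_pi_apply i)).const_mul _
  convert h1.inter (measurableSet_le h2 (measurable_const (a := t))) using 1
  ext v
  simp [mulSublevel]

theorem convexComb_mem_mulSublevel {n : ℕ} {I J : Set ℝ} {φ ψ : ℝ → ℝ}
    (hg : ConvexOn ℝ (I ×ˢ J) fun p : ℝ × ℝ => φ p.1 * ψ p.2) {t : ℝ} {x y v w : Fin n → ℝ}
    (hx : ∀ i, x i ∈ I) (hy : ∀ i, y i ∈ I) (hv : v ∈ mulSublevel J φ ψ t x)
    (hw : w ∈ mulSublevel J φ ψ t y) {a b : ℝ} (ha : 0 ≤ a) (hb : 0 ≤ b) (hab : a + b = 1) :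
    a • v + b • w ∈ mulSublevel J φ ψ t (a • x + b • y) := by
  have hmem : ∀ i, (x i, v i) ∈ I ×ˢ J := fun i => ⟨hx i, hv.1 i⟩
  have hmem' : ∀ i, (y i, w i) ∈ I ×ˢ J := fun i => ⟨hy i, hw.1 i⟩
  refine ⟨fun i => (hg.1 (hmem i) (hmem' i) ha hb hab).2, ?_⟩
  calc ∑ i, φ ((a • x + b • y) i) * ψ ((a • v + b • w) i)
      ≤ ∑ i, (a * (φ (x i) * ψ (v i)) + b * (φ (y i) * ψ (w i))) :=
        Finset.sum_le_sum fun i _ => hg.2 (hmem i) (hmem' i) ha hb hab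
    _ = a * ∑ i, φ (x i) * ψ (v i) + b * ∑ i, φ (y i) * ψ (w i) := by
        rw [Finset.sum_add_distrib, Finset.mul_sum, Finset.mul_sum]
    _ ≤ a * t + b * t :=
        add_le_add (mul_le_mul_of_nonneg_left hv.2 ha) (mul_le_mul_of_nonneg_left hw.2 hb)
    _ = t := by rw [← add_mul, hab, one_mul]

theorem measure_mulSublevel_comp_perm {n : ℕ} {J : Set ℝ} (φ ψ : ℝ → ℝ) (t : ℝ)
    (x : Fin n → ℝ) (μ : Measure ℝ) [SigmaFinite μ] (σ : Equiv.Perm (Fin n)) :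
    Measure.pi (fun _ => μ) (mulSublevel J φ ψ t (x ∘ σ)) =
      Measure.pi (fun _ => μ) (mulSublevel J φ ψ t x) := by
  have hp := measurePreserving_piCongrLeft (fun _ : Fin n => μ) σ
  rw [← hp.measure_preimage_equiv (mulSublevel J φ ψ t x)]
  congr 1
  ext v
  have e : ∀ i, MeasurableEquiv.piCongrLeft (fun _ => ℝ) σ v (σ i) = v i := fun i => by
    rw [MeasurableEquiv.coe_piCongrLeft]
    exact Equiv.piCongrLeft_apply_apply (fun _ => ℝ) σ v i
  simp only [mulSublevel, Set.mem_preimage, Set.mem_ofPred_eq]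
  generalize MeasurableEquiv.piCongrLeft (fun _ => ℝ) σ v = w at e ⊢
  rw [← Equiv.sum_comp σ (fun i => φ (x i) * ψ (w i)),
    ← σ.forall_congr_right (q := fun i => w i ∈ J)]
  simp only [e, Function.comp_apply]

/-- Prékopa–Leindler for indicators of sublevel sets makes `m` log-concave on `I ^ n`, so the points
of `I ^ n` where `m` is at least `m x` form a convex set. By symmetry it contains all rearrangements
of `x`. -/
theorem measure_mulSublevel_le_of_mem_permutohedron {n : ℕ} {μ : Measure ℝ} [SigmaFinite μ]
    (hμ : IsPrekopaLeindler μ) {I J : Set ℝ} (hI : Convex ℝ I) (hJ : MeasurableSet J)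
    {φ ψ : ℝ → ℝ} (hψ : Measurable ψ)
    (hg : ConvexOn ℝ (I ×ˢ J) fun p : ℝ × ℝ => φ p.1 * ψ p.2) {x z : Fin n → ℝ}
    (hx : ∀ i, x i ∈ I) (hz : z ∈ permutohedron x) (t : ℝ) :
    Measure.pi (fun _ => μ) (mulSublevel J φ ψ t x) ≤
      Measure.pi (fun _ => μ) (mulSublevel J φ ψ t z) := by
  set m : (Fin n → ℝ) → ENNReal := fun y => Measure.pi (fun _ => μ) (mulSublevel J φ ψ t y) with hm
  have hconv : Convex ℝ {y : Fin n → ℝ | (∀ i, y i ∈ I) ∧ m x ≤ m y} := by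
    intro y hy w hw a b ha hb hab
    refine ⟨fun i => hI (hy.1 i) (hw.1 i) ha hb hab, ?_⟩
    rcases ha.eq_or_lt with rfl | ha'
    · rw [zero_add] at hab
      subst hab
      simpa using hw.2
    rcases hb.eq_or_lt with rfl | hb'
    · rw [add_zero] at hab
      subst hab
      simpa using hy.2
    obtain rfl : b = 1 - a := by linarith
    have hmeas := fun y : Fin n → ℝ => measurableSet_mulSublevel hJ φ hψ t y
    have h := hμ.pi n a ⟨ha', by linarith⟩ ((mulSublevel J φ ψ t y).indicator 1)
      ((mulSublevel J φ ψ t w).indicator 1)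
      ((mulSublevel J φ ψ t (a • y + (1 - a) • w)).indicator 1)
      (measurable_one.indicator (hmeas _)) (measurable_one.indicator (hmeas _))
      (measurable_one.indicator (hmeas _)) fun v v' => by
        by_cases hv : v ∈ mulSublevel J φ ψ t y
        · by_cases hv' : v' ∈ mulSublevel J φ ψ t w
          · have := convexComb_mem_mulSublevel hg hy.1 hw.1 hv hv' ha hb hab
            simp [hv, hv', this]
          · simp [hv', hb']
        · simp [hv, ha']
    simp only [lintegral_indicator_one (hmeas _)] at h
    calc m x = m x ^ a * m x ^ (1 - a) := by
          rw [← ENNReal.rpow_add_of_nonneg _ _ ha hb]; simp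
      _ ≤ m y ^ a * m w ^ (1 - a) :=
          mul_le_mul' (ENNReal.rpow_le_rpow hy.2 ha) (ENNReal.rpow_le_rpow hw.2 hb)
      _ ≤ _ := h
  refine (convexHull_min ?_ hconv hz).2
  rintro _ ⟨σ, rfl⟩
  exact ⟨fun i => hx _, (measure_mulSublevel_comp_perm φ ψ t x μ σ).ge⟩

/-! ### Distribution functions and the stochastic comparison. -/

/-- The distribution function of a linear combination of i.i.d. variables that are functions of
a variable `Y`, in terms of the law of `Y`. -/
theorem measure_sum_mul_le_eq {Ω : Type*} [MeasurableSpace Ω] {P : Measure Ω}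
    [IsProbabilityMeasure P] {n : ℕ} {X : Fin n → Ω → ℝ} (hX : ∀ i, Measurable (X i))
    (hindep : iIndepFun X P) {i₀ : Fin n} (hident : ∀ i, IdentDistrib (X i) (X i₀) P P)
    {J : Set ℝ} (hJ : MeasurableSet J) {ψ : ℝ → ℝ} (hψ : Measurable ψ) {Y : Ω → ℝ}
    (hY : AEMeasurable Y P) (hYJ : ∀ᵐ ω ∂P, Y ω ∈ J) (hYX : ∀ᵐ ω ∂P, X i₀ ω = ψ (Y ω))
    (φ : ℝ → ℝ) (x : Fin n → ℝ) (t : ℝ) :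
    P {ω | ∑ i, φ (x i) * X i ω ≤ t} =
      Measure.pi (fun _ => P.map Y) (mulSublevel J φ ψ t x) := by
  have : IsProbabilityMeasure (P.map Y) := Measure.isProbabilityMeasure_map hY
  have hlaw : ∀ i, P.map (X i) = (P.map Y).map ψ := fun i => by
    rw [(hident i).map_eq, AEMeasurable.map_map_of_aemeasurable hψ.aemeasurable hY]
    exact Measure.map_congr hYX
  have : IsProbabilityMeasure ((P.map Y).map ψ) :=
    Measure.isProbabilityMeasure_map hψ.aemeasurable
  have hjoint := (iIndepFun_iff_map_fun_eq_pi_map fun i => (hX i).aemeasurable).1 hindep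
  simp only [hlaw] at hjoint
  rw [← Measure.pi_map_pi fun _ => hψ.aemeasurable] at hjoint
  have hS : MeasurableSet {v : Fin n → ℝ | ∑ i, φ (x i) * v i ≤ t} :=
    measurableSet_le (Finset.measurable_sum _ fun i _ => (measurable_pi_apply i).const_mul _)
      measurable_const
  have h1 : P {ω | ∑ i, φ (x i) * X i ω ≤ t} =
      P.map (fun ω i => X i ω) {v : Fin n → ℝ | ∑ i, φ (x i) * v i ≤ t} :=
    (Measure.map_apply (measurable_pi_lambda _ hX) hS).symm
  have hψn : Measurable fun (v : Fin n → ℝ) i => ψ (v i) :=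
    measurable_pi_lambda _ fun i => hψ.comp (measurable_pi_apply i)
  rw [h1, hjoint, Measure.map_apply hψn hS]
  refine measure_congr ?_
  have hall : ∀ᵐ v ∂Measure.pi (fun _ : Fin n => P.map Y), ∀ i, v i ∈ J :=
    ae_all_iff.2 fun i => (measurePreserving_eval (fun _ : Fin n => P.map Y)
      i).quasiMeasurePreserving.ae ((ae_map_iff hY hJ).2 hYJ)
  filter_upwards [hall] with v hv
  exact propext ⟨fun h => ⟨hv, h⟩, fun h => h.2⟩

theorem theorem3p1 {Ω : Type*} [MeasurableSpace Ω] (P : Measure Ω) [IsProbabilityMeasure P]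
    (n : ℕ) (hn : 0 < n) (X : Fin n → Ω → ℝ)
    (hX_meas : ∀ i, Measurable (X i))
    (hX_indep : iIndepFun X P)
    (hX_ident : ∀ i j, IdentDistrib (X i) (X j) P P)
    (hX_ac : ∀ i, P.map (X i) ≪ volume)
    (hX_nonneg : ∀ i, ∀ᵐ ω ∂P, 0 ≤ X i ω)
    -- the nondegenerate intervals on which `φ` and `ψ` are defined, for example `[0, ∞)` or `(0, ∞)`
    (I J : Set ℝ) (hI : I.OrdConnected) (hJ : J.OrdConnected)
    (hI_nt : I.Nontrivial) (hJ_nt : J.Nontrivial)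
    (φ ψ : ℝ → ℝ)
    (hφ_maps : ∀ u ∈ I, 0 ≤ φ u) (hψ_maps : ∀ v ∈ J, 0 ≤ ψ v)
    (hφ_C2 : ContDiffOn ℝ 2 φ I) (hψ_C2 : ContDiffOn ℝ 2 ψ J)
    (hφ_mono : StrictMonoOn φ I ∨ StrictAntiOn φ I)
    (hψ_mono : StrictMonoOn ψ J ∨ StrictAntiOn ψ J)
    (hφ_conv : ∀ u ∈ I, 0 ≤ iteratedDerivWithin 2 φ I u)
    (hφψ : ∀ u ∈ I, ∀ v ∈ J,
      (derivWithin φ I u * derivWithin ψ J v) ^ 2 ≤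
        iteratedDerivWithin 2 φ I u * iteratedDerivWithin 2 ψ J v * φ u * ψ v)
    -- `ψ⁻¹(X₁)` is defined almost surely, and has a log-concave density
    (hX_range : ∀ᵐ ω ∂P, X ⟨0, hn⟩ ω ∈ ψ '' J)
    (hX_logconcave :
      HasLogConcaveDensity P (fun ω => Function.invFunOn ψ J (X ⟨0, hn⟩ ω)))
    -- `φ⁻¹(aᵢ)` and `φ⁻¹(bᵢ)` are defined
    (a b : Fin n → ℝ) (ha : ∀ i, a i ∈ φ '' I) (hb : ∀ i, b i ∈ φ '' I) :
    (MajorizedBy (fun i => Function.invFunOn φ I (b i)) (fun i => Function.invFunOn φ I (a i)) →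
      StochLE P (fun ω => ∑ i, b i * X i ω) (fun ω => ∑ i, a i * X i ω)) ∧
    (StrictMonoOn φ I →
      SubmajorizedBy (fun i => Function.invFunOn φ I (b i))
        (fun i => Function.invFunOn φ I (a i)) →
      StochLE P (fun ω => ∑ i, b i * X i ω) (fun ω => ∑ i, a i * X i ω)) ∧
    (StrictAntiOn φ I →
      SupmajorizedBy (fun i => Function.invFunOn φ I (b i))
        (fun i => Function.invFunOn φ I (a i)) →
      StochLE P (fun ω => ∑ i, b i * X i ω) (fun ω => ∑ i, a i * X i ω)) := by
  have hJm : MeasurableSet J := hJ.measurableSet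
  have hφ_inj : Set.InjOn φ I := hφ_mono.elim StrictMonoOn.injOn StrictAntiOn.injOn
  -- `ψ` is controlled only on `J`; its extension by `0` is measurable on the whole line.
  have hg := (convexOn_mul_of_iteratedDerivWithin hI hJ hI_nt hJ_nt hφ_maps hψ_maps hφ_C2 hψ_C2
    hφ_inj hφ_conv hφψ).congr (g := fun p => φ p.1 * J.indicator ψ p.2) fun p hp => by
      simp [Set.indicator_of_mem hp.2]
  have hψm : Measurable (J.indicator ψ) := by
    classical
    rw [← Set.piecewise_eq_indicator]
    exact hψ_C2.continuousOn.measurable_piecewise continuousOn_const hJm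
  obtain ⟨hY, f, hfm, hf0, hfc, hfY⟩ := hX_logconcave
  set Y : Ω → ℝ := fun ω => Function.invFunOn ψ J (X ⟨0, hn⟩ ω) with hY_def
  have hYJ : ∀ᵐ ω ∂P, Y ω ∈ J := by
    filter_upwards [hX_range] with ω hω using Function.invFunOn_mem hω
  have hYX : ∀ᵐ ω ∂P, X ⟨0, hn⟩ ω = J.indicator ψ (Y ω) := by
    filter_upwards [hX_range] with ω hω
    rw [Set.indicator_of_mem (Function.invFunOn_mem hω)]
    exact (Function.invFunOn_eq hω).symm
  have hprob : IsProbabilityMeasure (P.map Y) := Measure.isProbabilityMeasure_map hY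
  have hPL : IsPrekopaLeindler (P.map Y) :=
    hfY ▸ isPrekopaLeindler_withDensity_of_logConcaveOn hfm hf0 hfc
  set x : Fin n → ℝ := fun i => Function.invFunOn φ I (a i) with hx_def
  set y : Fin n → ℝ := fun i => Function.invFunOn φ I (b i) with hy_def
  have hx : ∀ i, x i ∈ I := fun i => Function.invFunOn_mem (ha i)
  have hy : ∀ i, y i ∈ I := fun i => Function.invFunOn_mem (hb i)
  have hφx : ∀ i, φ (x i) = a i := fun i => Function.invFunOn_eq (ha i)
  have hφy : ∀ i, φ (y i) = b i := fun i => Function.invFunOn_eq (hb i)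
  have main : ∀ z ∈ permutohedron x, (∀ i, φ (y i) ≤ φ (z i)) →
      StochLE P (fun ω => ∑ i, b i * X i ω) (fun ω => ∑ i, a i * X i ω) := by
    intro z hz hyz t
    have h1 := measure_mulSublevel_le_of_mem_permutohedron hPL hI.convex hJm hψm hg hx hz t
    rw [← measure_sum_mul_le_eq hX_meas hX_indep (fun i => hX_ident i _) hJm hψm hY hYJ hYX,
      ← measure_sum_mul_le_eq hX_meas hX_indep (fun i => hX_ident i _) hJm hψm hY hYJ hYX] at h1
    simp only [hφx] at h1
    -- From `z` to `y` the comparison is pointwise: smaller coefficients on nonnegative variables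
    -- give a smaller sum.
    refine h1.trans (measure_mono_ae ?_)
    filter_upwards [ae_all_iff.2 hX_nonneg] with ω hω hle
    refine le_trans (Finset.sum_le_sum fun i _ => ?_) hle
    exact mul_le_mul_of_nonneg_right (hφy i ▸ hyz i) (hω i)
  have sub : StrictMonoOn φ I → SubmajorizedBy y x →
      StochLE P (fun ω => ∑ i, b i * X i ω) (fun ω => ∑ i, a i * X i ω) := by
    intro hφ h
    obtain ⟨z, hz, hyz⟩ := h.exists_le_mem_permutohedron
    exact main z hz fun i =>
      hφ.monotoneOn (hy i) (permutohedron_subset_pi hI.convex hx hz i) (hyz i)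
  have sup : StrictAntiOn φ I → SupmajorizedBy y x →
      StochLE P (fun ω => ∑ i, b i * X i ω) (fun ω => ∑ i, a i * X i ω) := by
    intro hφ h
    obtain ⟨z, hz, hzy⟩ := h.exists_mem_permutohedron_le
    exact main z hz fun i =>
      hφ.antitoneOn (permutohedron_subset_pi hI.convex hx hz i) (hy i) (hzy i)
  -- Majorization implies both weak forms; the direction of `φ` selects the one to use.
  exact ⟨fun h => hφ_mono.elim (fun hφ => sub hφ h.submajorizedBy)
    (fun hφ => sup hφ h.supmajorizedBy), sub, sup⟩
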